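/- Let $p \ge 1$ be a real number and let $(X,d)$ be a complete metric space (not necessarily separable). A Borel probability measure $\mu$ on $X$ is called Radon if $\mu(B) = \sup\{\mu(K) : K \subseteq B,\ K \text{ compact}\}$ for every Borel set $B \subseteq X$, and is said to have finite moment of order $p$ if $\int d(x_0,x)^p \,\mathrm{d}\mu(x) < \infty$ for some $x_0 \in X$. Let $P_p(X)$ be the set of Radon probability measures on $X$ with finite moment of order $p$, equipped with the Wasserstein distance $$W_p(\mu,\nu) = \Bigl(\inf_{\gamma} \int_{X\times X} d(x,y)^p \,\mathrm{d}\gamma(x,y)\Bigr)^{1/p},$$ where $\gamma$ runs over the couplings of $\mu$ and $\nu$, that is, the Borel probability measures on $X \times X$ whose first and second marginals are $\mu$ and $\nu$. The support of $\mu$ is the set of points all of whose open neighbourhoods have positive $\mu$-measure. Then $W_p$ is a (finite-valued) metric on $P_p(X)$, the metric space $(P_p(X), W_p)$ is complete, and the measures in $P_p(X)$ with finite support are dense in it. -/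

import Mathlib

open MeasureTheory
open scoped ENNReal

noncomputable section

/-- `γ` is a coupling between the Borel probability measures `μ` and `ν` on `X`: a measure on the
Borel σ-algebra of the product topology of `X × X` with marginals `μ` and `ν`. This σ-algebra is
written out, since for a non-separable `X` it can be strictly larger than the product σ-algebra,
which is Mathlib's default on `X × X`. That `γ` has total mass one follows from the marginals. -/
def IsBorelCoupling {X : Type*} [TopologicalSpace X] [MeasurableSpace X]
    (γ : @Measure (X × X) (borel (X × X))) (μ ν : ProbabilityMeasure X) : Prop :=
  @Measure.map (X × X) X (borel (X × X)) _ Prod.fst γ = (μ : Measure X) ∧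
  @Measure.map (X × X) X (borel (X × X)) _ Prod.snd γ = (ν : Measure X)

/-- The Wasserstein distance of order `p`, as an extended non-negative real:
`(inf_γ ∫ d(x, y) ^ p dγ(x, y)) ^ (1 / p)`, with `γ` running over the couplings of `μ` and `ν`. -/
def wassersteinEDist {X : Type*} [MetricSpace X] [MeasurableSpace X]
    (p : ℝ) (μ ν : ProbabilityMeasure X) : ℝ≥0∞ :=
  (⨅ (γ : @Measure (X × X) (borel (X × X))) (_ : IsBorelCoupling γ μ ν),
    @lintegral (X × X) (borel (X × X)) γ (fun z => edist z.1 z.2 ^ p)) ^ (1 / p)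

/-- `μ` has finite moment of order `p`. -/
def HasFiniteMoment {X : Type*} [MetricSpace X] [MeasurableSpace X]
    (p : ℝ) (μ : ProbabilityMeasure X) : Prop :=
  ∃ x₀ : X, ∫⁻ x, edist x₀ x ^ p ∂(μ : Measure X) < ∞

/-- The set `P_p(X)` of Radon probability measures on `X` with finite moment of order `p`.
`Measure.InnerRegular` says that every Borel set is inner regular with respect to compact sets.
This is a `def`, so that no topology is inherited from `ProbabilityMeasure X`. -/
def WassersteinSpace (p : ℝ) (X : Type*) [MetricSpace X] [MeasurableSpace X] : Type _ :=
  {μ : ProbabilityMeasure X // (μ : Measure X).InnerRegular ∧ HasFiniteMoment p μ}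

/-- The probability measure underlying a point of `P_p(X)`. -/
def WassersteinSpace.toProb {p : ℝ} {X : Type*} [MetricSpace X] [MeasurableSpace X]
    (μ : WassersteinSpace p X) : ProbabilityMeasure X :=
  Subtype.val μ

end

/-! Everything reduces to a separable subspace. Countably many Radon measures are carried by one
closed separable set `S`, which is Polish when `X` is complete. A measurable retraction of `X` onto
`S` moves couplings to `S × S`, where the product σ-algebra is the Borel one. So `W_p` is the
infimum of `L^p` distances between `S`-valued random variables with the prescribed laws
(`wassersteinEDist_le_lpEDist`, `exists_lpEDist_lt_of_wassersteinEDist_lt`).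

Disintegration glues a sequence of near-optimal couplings into one Markov chain
(`exists_realization_of_wassersteinEDist_lt`), and no optimal coupling is needed. The triangle
inequality becomes Minkowski's, and completeness becomes that of `L^p`: the law of the limit
variable is Radon because it comes from `S`. Distance zero forces equality by Markov's inequality
and the Lévy–Prokhorov distance, and density is approximation by simple functions. -/

open MeasureTheory ProbabilityTheory Filter Topology
open scoped ENNReal

noncomputable section

/-! ### `L^p` distances of metric-space-valued maps -/

section LpEDist

variable {Ω X : Type*} [MeasurableSpace Ω] [MetricSpace X]

/-- The `L^p` distance of two maps with values in a metric space. -/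
def lpEDist (p : ℝ) (P : Measure Ω) (f g : Ω → X) : ℝ≥0∞ :=
  (∫⁻ ω, edist (f ω) (g ω) ^ p ∂P) ^ (1 / p)

theorem lpEDist_lt_top_iff {p : ℝ} (hp : 0 < p) {P : Measure Ω} {f g : Ω → X} :
    lpEDist p P f g < ∞ ↔ ∫⁻ ω, edist (f ω) (g ω) ^ p ∂P < ∞ := by
  unfold lpEDist
  rw [ENNReal.rpow_lt_top_iff_of_pos (by positivity)]

theorem lpEDist_comm (p : ℝ) (P : Measure Ω) (f g : Ω → X) :
    lpEDist p P f g = lpEDist p P g f := by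
  simp only [lpEDist, edist_comm]

theorem lpEDist_self {p : ℝ} (hp : 0 < p) (P : Measure Ω) (f : Ω → X) :
    lpEDist p P f f = 0 := by
  simp [lpEDist, ENNReal.zero_rpow_of_pos, hp]

theorem lpEDist_triangle {p : ℝ} (hp : 1 ≤ p) {P : Measure Ω} {f g h : Ω → X}
    (hfg : AEMeasurable (fun ω => edist (f ω) (g ω)) P)
    (hgh : AEMeasurable (fun ω => edist (g ω) (h ω)) P) :
    lpEDist p P f h ≤ lpEDist p P f g + lpEDist p P g h := by
  refine le_trans ?_ (ENNReal.lintegral_Lp_add_le hfg hgh hp)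
  unfold lpEDist
  gcongr
  exact edist_triangle _ _ _

theorem lpEDist_map {Ω' : Type*} [MeasurableSpace Ω'] {p : ℝ} {P : Measure Ω} {φ : Ω → Ω'}
    (hφ : Measurable φ) {f g : Ω' → X} (hfg : Measurable fun ω => edist (f ω) (g ω)) :
    lpEDist p (P.map φ) f g = lpEDist p P (f ∘ φ) (g ∘ φ) := by
  unfold lpEDist
  rw [lintegral_map (hfg.pow_const p) hφ]
  rfl

theorem lintegral_edist_le_lpEDist {p : ℝ} (hp : 1 ≤ p) {P : Measure Ω} [IsProbabilityMeasure P]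
    {f g : Ω → X} (hfg : Measurable fun ω => edist (f ω) (g ω)) :
    ∫⁻ ω, edist (f ω) (g ω) ∂P ≤ lpEDist p P f g := by
  have := eLpNorm'_le_eLpNorm'_of_exponent_le zero_lt_one hp P hfg.aestronglyMeasurable
  simpa [eLpNorm', lpEDist] using this

end LpEDist

/-! ### Completeness of `L^p` -/

section LpComplete

variable {Ω S : Type*} [MeasurableSpace Ω] [MetricSpace S] [SecondCountableTopology S]
  [MeasurableSpace S] [BorelSpace S]

theorem lpEDist_le_sum {p : ℝ} (hp : 1 ≤ p) {P : Measure Ω} {f : ℕ → Ω → S}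
    (hf : ∀ n, Measurable (f n)) {b : ℕ → ℝ≥0∞} (hb : ∀ n, lpEDist p P (f n) (f (n + 1)) ≤ b n)
    (n m : ℕ) : lpEDist p P (f n) (f (n + m)) ≤ ∑ k ∈ Finset.range m, b (k + n) := by
  induction m with
  | zero => simp [lpEDist_self (zero_lt_one.trans_le hp)]
  | succ m ih =>
    rw [Finset.sum_range_succ]
    refine (lpEDist_triangle hp (((hf n).edist (hf (n + m))).aemeasurable)
      (((hf (n + m)).edist (hf (n + m + 1))).aemeasurable)).trans ?_
    exact add_le_add ih ((hb (n + m)).trans_eq (by rw [add_comm]))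

/-- A sequence of random variables in a complete separable metric space whose successive `L^p`
distances are summable converges in `L^p`. -/
theorem exists_lpEDist_le_tsum [CompleteSpace S] {p : ℝ} (hp : 1 ≤ p) {P : Measure Ω}
    [IsProbabilityMeasure P] {f : ℕ → Ω → S} (hf : ∀ n, Measurable (f n)) {b : ℕ → ℝ≥0∞}
    (hb : ∀ n, lpEDist p P (f n) (f (n + 1)) ≤ b n) (hsum : ∑' n, b n ≠ ∞) :
    ∃ g : Ω → S, Measurable g ∧ ∀ n, lpEDist p P (f n) g ≤ ∑' k, b (k + n) := by
  have hp0 : 0 < p := zero_lt_one.trans_le hp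
  have hm : ∀ n m, Measurable fun ω => edist (f n ω) (f m ω) := fun n m => (hf n).edist (hf m)
  -- The total path length has finite mean, since `L^1` distances are at most `L^p` distances under
  -- a probability measure; hence almost every path is Cauchy.
  have hfin : ∀ᵐ ω ∂P, ∑' n, edist (f n ω) (f (n + 1) ω) < ∞ := by
    refine ae_lt_top (Measurable.tsum fun n => hm n (n + 1)) (ne_top_of_le_ne_top hsum ?_)
    rw [lintegral_tsum fun n => (hm n (n + 1)).aemeasurable]
    exact ENNReal.tsum_le_tsum fun n => (lintegral_edist_le_lpEDist hp (hm _ _)).trans (hb n)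
  have hlim : ∀ᵐ ω ∂P, ∃ l, Tendsto (fun n => f n ω) atTop (𝓝 l) := by
    filter_upwards [hfin] with ω hω
    exact cauchySeq_tendsto_of_complete
      (cauchySeq_of_edist_le_of_tsum_ne_top _ (fun n => le_rfl) hω.ne)
  obtain ⟨g, hg, hfg⟩ :=
    measurable_limit_of_tendsto_metrizable_ae (fun n => (hf n).aemeasurable) hlim
  refine ⟨g, hg, fun n => ?_⟩
  -- Fatou's lemma as `m → ∞`, applied to the bounds on `lpEDist p P (f n) (f (n + m))`.
  have hle : ∫⁻ ω, edist (f n ω) (g ω) ^ p ∂P ≤ (∑' k, b (k + n)) ^ p := by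
    calc ∫⁻ ω, edist (f n ω) (g ω) ^ p ∂P
        = ∫⁻ ω, liminf (fun m => edist (f n ω) (f (n + m) ω) ^ p) atTop ∂P := by
          refine lintegral_congr_ae ?_
          filter_upwards [hfg] with ω hω
          refine (Tendsto.liminf_eq ?_).symm
          have h1 : Tendsto (fun m => f (n + m) ω) atTop (𝓝 (g ω)) :=
            hω.comp (tendsto_add_atTop_nat n |>.congr fun m => add_comm _ _)
          exact (ENNReal.continuous_rpow_const.tendsto _).comp (tendsto_const_nhds.edist h1)
      _ ≤ liminf (fun m => ∫⁻ ω, edist (f n ω) (f (n + m) ω) ^ p ∂P) atTop :=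
          lintegral_liminf_le fun m => (hm _ _).pow_const p
      _ ≤ (∑' k, b (k + n)) ^ p := by
          refine liminf_le_of_le (by isBoundedDefault) fun a ha => ?_
          obtain ⟨m, hm'⟩ := ha.exists
          refine hm'.trans ?_
          have := (lpEDist_le_sum hp hf hb n m).trans (ENNReal.sum_le_tsum _)
          rwa [lpEDist, one_div, ENNReal.rpow_inv_le_iff hp0] at this
  rwa [lpEDist, one_div, ENNReal.rpow_inv_le_iff hp0]

end LpComplete

/-! ### Gluing couplings -/

section Gluing

variable {S : Type*} [MeasurableSpace S] [StandardBorelSpace S] [Nonempty S]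

/-- The gluing lemma for a sequence of couplings, each starting where the previous one ends. -/
theorem exists_measure_map_succ_eq (γ : ℕ → Measure (S × S)) [∀ n, IsProbabilityMeasure (γ n)]
    (h : ∀ n, (γ n).snd = (γ (n + 1)).fst) :
    ∃ P : Measure (ℕ → S), IsProbabilityMeasure P ∧
      ∀ n, P.map (fun ω => (ω n, ω (n + 1))) = γ n := by
  -- The transition kernel sees only the last coordinate of the past, so the glued process is a
  -- Markov chain.
  let κ : (n : ℕ) → Kernel (∀ _ : Finset.Iic n, S) S := fun n =>
    ((γ n).condKernel).comap (fun x => x ⟨n, Finset.mem_Iic.2 le_rfl⟩) (measurable_pi_apply _)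
  have hκ : ∀ n, IsMarkovKernel (κ n) := fun n => by dsimp only [κ]; infer_instance
  let P : Measure (ℕ → S) := Kernel.trajMeasure (X := fun _ => S) (γ 0).fst κ
  have hP : IsProbabilityMeasure P := by dsimp only [P]; infer_instance
  refine ⟨P, hP, ?_⟩
  -- If the law at time `n` is correct, disintegration of `γ n` gives the joint law at times `n` and
  -- `n + 1`, and its second marginal starts the next step.
  have step : ∀ n, P.map (fun ω => ω n) = (γ n).fst →
      P.map (fun ω => (ω n, ω (n + 1))) = γ n := by
    intro n hn
    have h1 : (P.map (Preorder.frestrictLe n)) ⊗ₘ κ n =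
        P.map (fun x => (Preorder.frestrictLe n x, x (n + 1))) :=
      Kernel.map_frestrictLe_trajMeasure_compProd_eq_map_trajMeasure
    have hev : Measurable fun x : (∀ _ : Finset.Iic n, S) => x ⟨n, Finset.mem_Iic.2 le_rfl⟩ :=
      measurable_pi_apply _
    have h2 : P.map (fun ω => (ω n, ω (n + 1))) =
        ((P.map (Preorder.frestrictLe n)) ⊗ₘ κ n).map
          (Prod.map (fun x => x ⟨n, Finset.mem_Iic.2 le_rfl⟩) id) := by
      rw [h1, Measure.map_map (by fun_prop) (by fun_prop)]
      rfl
    have h3 : ((P.map (Preorder.frestrictLe n)).map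
        fun x : (∀ _ : Finset.Iic n, S) => x ⟨n, Finset.mem_Iic.2 le_rfl⟩) = (γ n).fst := by
      rw [← hn, Measure.map_map hev (by fun_prop)]
      rfl
    have hPn : IsProbabilityMeasure (P.map (Preorder.frestrictLe (π := fun _ => S) n)) :=
      Measure.isProbabilityMeasure_map (by fun_prop)
    rw [h2]
    conv_rhs => rw [← (γ n).disintegrate (γ n).condKernel, ← h3]
    ext s hs
    rw [Measure.map_apply (by fun_prop) hs, Measure.compProd_apply hs,
      Measure.compProd_apply (hs.preimage (by fun_prop)), lintegral_map _ hev]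
    · rfl
    · exact Kernel.measurable_kernel_prodMk_left hs
  intro n
  refine step n ?_
  induction n with
  | zero =>
    have h0 : P.map (Preorder.frestrictLe 0) =
        (γ 0).fst.map (MeasurableEquiv.piUnique fun _ : Finset.Iic 0 => S).symm := by
      dsimp only [P]
      rw [Kernel.trajMeasure, Measure.map_comp _ _ (by fun_prop), Kernel.traj_map_frestrictLe,
        Kernel.partialTraj_self, Measure.id_comp]
    have h1 : P.map (fun ω => ω 0) = (P.map (Preorder.frestrictLe 0)).map
        (fun x : (∀ _ : Finset.Iic 0, S) => x ⟨0, Finset.mem_Iic.2 le_rfl⟩) := by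
      rw [Measure.map_map (by fun_prop) (by fun_prop)]
      rfl
    rw [h1, h0, Measure.map_map (by fun_prop) (by fun_prop)]
    exact Measure.map_id
  | succ n ih =>
    have := step n ih
    rw [← h n, ← this, Measure.snd, Measure.map_map (by fun_prop) (by fun_prop)]
    rfl

end Gluing

/-! ### Retraction onto a measurable carrier -/

section Retraction

variable {X : Type*} [MeasurableSpace X]

theorem exists_measurable_retraction {S : Set X} (hS : MeasurableSet S) (hne : S.Nonempty) :
    ∃ r : X → S, Measurable r ∧ ∀ x : S, r x = x := by
  obtain ⟨r, hr, h⟩ := (MeasurableEmbedding.subtype_coe hS).exists_measurable_extend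
    (measurable_id (α := S)) (fun _ => hne.to_subtype)
  exact ⟨r, hr, congrFun h⟩

theorem ae_retraction_eq {S : Set X} {r : X → S} (hr : ∀ x : S, r x = x) {μ : Measure X}
    (hμ : μ Sᶜ = 0) : ∀ᵐ x ∂μ, (r x : X) = x := by
  filter_upwards [mem_ae_iff.2 hμ] with x hx
  exact congrArg Subtype.val (hr ⟨x, hx⟩)

theorem map_coe_map_retraction {S : Set X} {r : X → S} (hrm : Measurable r)
    (hr : ∀ x : S, r x = x) {μ : Measure X} (hμ : μ Sᶜ = 0) :
    (μ.map r).map (Subtype.val : S → X) = μ := by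
  rw [Measure.map_map measurable_subtype_coe hrm]
  conv_rhs => rw [← Measure.map_id (μ := μ)]
  exact Measure.map_congr (ae_retraction_eq hr hμ)

theorem map_coe_eq_of_map_eq {S : Set X} {r : X → S} (hrm : Measurable r) (hr : ∀ x : S, r x = x)
    {μ : Measure X} (hμ : μ Sᶜ = 0) {Ω : Type*} [MeasurableSpace Ω] {P : Measure Ω} {f : Ω → S}
    (hf : Measurable f) (h : P.map f = μ.map r) : P.map (fun ω => (f ω : X)) = μ := by
  rw [← map_coe_map_retraction hrm hr hμ, ← h, Measure.map_map measurable_subtype_coe hf]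
  rfl

end Retraction

/-! ### Couplings as random variables in a separable subspace -/

section Realization

variable {X : Type*} [MetricSpace X] [MeasurableSpace X] [BorelSpace X]

/-- Random variables with values in a separable subspace bound the Wasserstein distance of their
laws. -/
theorem wassersteinEDist_le_lpEDist {Ω : Type*} [MeasurableSpace Ω] {p : ℝ} (hp : 0 < p)
    {P : Measure Ω} {S : Set X} [SecondCountableTopology S] {f g : Ω → S} (hf : Measurable f)
    (hg : Measurable g) {μ ν : ProbabilityMeasure X} (hμ : P.map (fun ω => (f ω : X)) = μ)
    (hν : P.map (fun ω => (g ω : X)) = ν) :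
    wassersteinEDist p μ ν ≤ lpEDist p P f g := by
  -- Second countability of `S` matters here: the product σ-algebra on `S × S` is Borel, so the
  -- continuous inclusion is measurable into the larger σ-algebra `borel (X × X)`.
  have hι : @Measurable (S × S) (X × X) _ (borel (X × X)) (fun z => ((z.1 : X), (z.2 : X))) := by
    let := borel (X × X); have : BorelSpace (X × X) := ⟨rfl⟩
    have hc : Continuous fun z : S × S => ((z.1 : X), (z.2 : X)) := by fun_prop
    exact hc.measurable
  have hφ : @Measurable Ω (X × X) _ (borel (X × X)) (fun ω => ((f ω : X), (g ω : X))) :=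
    hι.comp (hf.prodMk hg)
  have h1 : @Measurable (X × X) X (borel (X × X)) _ Prod.fst := by
    let := borel (X × X); have : BorelSpace (X × X) := ⟨rfl⟩
    exact continuous_fst.measurable
  have h2 : @Measurable (X × X) X (borel (X × X)) _ Prod.snd := by
    let := borel (X × X); have : BorelSpace (X × X) := ⟨rfl⟩
    exact continuous_snd.measurable
  have he : @Measurable (X × X) ℝ≥0∞ (borel (X × X)) _ (fun z => edist z.1 z.2 ^ p) := by
    let := borel (X × X); have : BorelSpace (X × X) := ⟨rfl⟩
    exact (ENNReal.continuous_rpow_const.comp continuous_edist).measurable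
  unfold wassersteinEDist lpEDist
  gcongr
  refine iInf₂_le_of_le (@Measure.map _ _ _ (borel (X × X))
    (fun ω => ((f ω : X), (g ω : X))) P) ⟨?_, ?_⟩ ?_
  · rw [@Measure.map_map _ _ _ _ (borel (X × X)) _ _ _ _ h1 hφ]
    exact hμ
  · rw [@Measure.map_map _ _ _ _ (borel (X × X)) _ _ _ _ h2 hφ]
    exact hν
  · rw [@lintegral_map _ _ _ (borel (X × X)) _ _ _ he hφ]
    rfl

/-- Couplings of measures carried by a separable subspace can be taken on that subspace. -/
theorem exists_lpEDist_lt_of_wassersteinEDist_lt {p : ℝ} (hp : 0 < p) {S : Set X}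
    [SecondCountableTopology S] {r : X → S} (hrm : Measurable r) (hr : ∀ x : S, r x = x)
    {μ ν : ProbabilityMeasure X} (hμ : (μ : Measure X) Sᶜ = 0) (hν : (ν : Measure X) Sᶜ = 0)
    {c : ℝ≥0∞} (h : wassersteinEDist p μ ν < c) :
    ∃ γ : Measure (S × S), IsProbabilityMeasure γ ∧ γ.fst = (μ : Measure X).map r ∧
      γ.snd = (ν : Measure X).map r ∧ lpEDist p γ Prod.fst Prod.snd < c := by
  rw [wassersteinEDist, one_div, ENNReal.rpow_inv_lt_iff hp] at h
  simp only [iInf_lt_iff] at h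
  obtain ⟨γ, hγ, hc⟩ := h
  let mXX : MeasurableSpace (X × X) := borel (X × X)
  have : BorelSpace (X × X) := ⟨rfl⟩
  have h1 : Measurable (Prod.fst : X × X → X) := continuous_fst.measurable
  have h2 : Measurable (Prod.snd : X × X → X) := continuous_snd.measurable
  have hγ1 : γ.map Prod.fst = (μ : Measure X) := hγ.1
  have hγ2 : γ.map Prod.snd = (ν : Measure X) := hγ.2
  have hφ : Measurable fun z : X × X => (r z.1, r z.2) := (hrm.comp h1).prodMk (hrm.comp h2)
  have hfst : (γ.map fun z => (r z.1, r z.2)).fst = (μ : Measure X).map r := by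
    rw [Measure.fst, Measure.map_map measurable_fst hφ, ← hγ1, Measure.map_map hrm h1]
    rfl
  refine ⟨γ.map fun z => (r z.1, r z.2), ?_, hfst, ?_, ?_⟩
  · have : IsProbabilityMeasure ((μ : Measure X).map r) :=
      Measure.isProbabilityMeasure_map hrm.aemeasurable
    constructor
    rw [← Measure.fst_univ, hfst, measure_univ]
  · rw [Measure.snd, Measure.map_map measurable_snd hφ, ← hγ2, Measure.map_map hrm h2]
    rfl
  · have hm : Measurable fun z : S × S => edist z.1 z.2 := measurable_edist
    rw [lpEDist_map hφ hm, lpEDist, one_div, ENNReal.rpow_inv_lt_iff hp]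
    refine lt_of_eq_of_lt (lintegral_congr_ae ?_) hc
    have a1 : ∀ᵐ z ∂γ, (r z.1 : X) = z.1 :=
      ae_of_ae_map h1.aemeasurable (hγ1 ▸ ae_retraction_eq hr hμ)
    have a2 : ∀ᵐ z ∂γ, (r z.2 : X) = z.2 :=
      ae_of_ae_map h2.aemeasurable (hγ2 ▸ ae_retraction_eq hr hν)
    filter_upwards [a1, a2] with z hz1 hz2
    simp only [Function.comp_apply, Subtype.edist_eq, hz1, hz2]

/-- Countably many Radon probability measures are carried by a common closed separable set. -/
theorem exists_isClosed_isSeparable_compl_null {ι : Type*} [Countable ι]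
    (μ : ι → ProbabilityMeasure X) (hμ : ∀ i, (μ i : Measure X).InnerRegular) :
    ∃ S : Set X, IsClosed S ∧ TopologicalSpace.IsSeparable S ∧
      ∀ i, (μ i : Measure X) Sᶜ = 0 := by
  have hK : ∀ i (n : ℕ),
      ∃ K : Set X, IsCompact K ∧ 1 - ((n : ℝ≥0∞) + 1)⁻¹ < (μ i : Measure X) K := by
    intro i n
    obtain ⟨K, -, hK, h⟩ := (hμ i).innerRegular MeasurableSet.univ (1 - ((n : ℝ≥0∞) + 1)⁻¹)
      (by rw [measure_univ]; exact ENNReal.sub_lt_self (by simp) (by simp) (by simp))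
    exact ⟨K, hK, h⟩
  choose K hKc hKμ using hK
  refine ⟨closure (⋃ i, ⋃ n, K i n), isClosed_closure,
    (TopologicalSpace.IsSeparable.iUnion fun i => TopologicalSpace.IsSeparable.iUnion fun n =>
      (hKc i n).isSeparable).closure, fun i => ?_⟩
  rw [prob_compl_eq_zero_iff isClosed_closure.measurableSet]
  refine le_antisymm prob_le_one (le_of_tendsto' (x := atTop)
    (f := fun n : ℕ => 1 - ((n : ℝ≥0∞) + 1)⁻¹) ?_ fun n => ?_)
  · have : Tendsto (fun n : ℕ => ((n : ℝ≥0∞) + 1)⁻¹) atTop (𝓝 0) := by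
      have := (tendsto_add_atTop_iff_nat 1).2 ENNReal.tendsto_inv_nat_nhds_zero
      simpa using this
    simpa using ENNReal.Tendsto.sub tendsto_const_nhds this (Or.inl ENNReal.one_ne_top)
  · refine (hKμ i n).le.trans (measure_mono ?_)
    exact (Set.subset_iUnion₂ (s := fun i n => K i n) i n).trans subset_closure

/-- The law of a random variable with values in a closed separable subspace, as a probability
measure on the ambient space, is Radon. -/
theorem innerRegular_map_coe {Ω : Type*} [MeasurableSpace Ω] [CompleteSpace X] {P : Measure Ω}
    [IsProbabilityMeasure P] {S : Set X} (hS : IsClosed S) [SecondCountableTopology S]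
    {f : Ω → S} (hf : Measurable f) : (P.map fun ω => (f ω : X)).InnerRegular := by
  have : CompleteSpace S := hS.completeSpace_coe
  have h : P.map (fun ω => (f ω : X)) = (P.map f).map Subtype.val := by
    rw [Measure.map_map measurable_subtype_coe hf]
    rfl
  rw [h]
  -- Finite Borel measures on the Polish space `S` are inner regular for compact sets, and
  -- continuous images of compact sets are compact.
  exact Measure.InnerRegular.map_of_continuous continuous_subtype_val

end Realization

/-! ### The metric axioms -/

section WassersteinMetric

variable {X : Type*} [MetricSpace X] [MeasurableSpace X] [BorelSpace X] {p : ℝ}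

theorem exists_separable_carrier {ι : Type*} [Countable ι] [Nonempty ι]
    (μ : ι → WassersteinSpace p X) :
    ∃ S : Set X, IsClosed S ∧ SecondCountableTopology S ∧
      (∀ i, ((μ i).toProb : Measure X) Sᶜ = 0) ∧
      ∃ r : X → S, Measurable r ∧ ∀ x : S, r x = x := by
  obtain ⟨S, hS, hsep, h⟩ :=
    exists_isClosed_isSeparable_compl_null (fun i => (μ i).toProb) fun i => (μ i).2.1
  have hne : S.Nonempty := by
    rw [Set.nonempty_iff_ne_empty]
    rintro rfl
    simpa using h (Classical.arbitrary ι)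
  have := hsep.separableSpace
  exact ⟨S, hS, UniformSpace.secondCountable_of_separable S, h,
    exists_measurable_retraction hS.measurableSet hne⟩

theorem wassersteinEDist_self (hp : 0 < p) (μ : WassersteinSpace p X) :
    wassersteinEDist p μ.toProb μ.toProb = 0 := by
  obtain ⟨S, hS, _, hμ, r, hrm, hr⟩ := exists_separable_carrier fun _ : Unit => μ
  have h := map_coe_eq_of_map_eq hrm hr (hμ ()) hrm rfl
  rw [← nonpos_iff_eq_zero, ← lpEDist_self hp (μ.toProb : Measure X) r]
  exact wassersteinEDist_le_lpEDist hp hrm hrm h h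

theorem wassersteinEDist_le_swap (hp : 0 < p) (μ ν : WassersteinSpace p X) :
    wassersteinEDist p ν.toProb μ.toProb ≤ wassersteinEDist p μ.toProb ν.toProb := by
  obtain ⟨S, hS, _, hc, r, hrm, hr⟩ := exists_separable_carrier ![μ, ν]
  have hμ : (μ.toProb : Measure X) Sᶜ = 0 := hc 0
  have hν : (ν.toProb : Measure X) Sᶜ = 0 := hc 1
  refine le_of_forall_gt fun c hlt => ?_
  obtain ⟨γ, _, h1, h2, hγ⟩ := exists_lpEDist_lt_of_wassersteinEDist_lt hp hrm hr hμ hν hlt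
  refine lt_of_le_of_lt ?_ hγ
  rw [lpEDist_comm]
  exact wassersteinEDist_le_lpEDist hp measurable_snd measurable_fst
    (map_coe_eq_of_map_eq hrm hr hν measurable_snd h2)
    (map_coe_eq_of_map_eq hrm hr hμ measurable_fst h1)

theorem wassersteinEDist_comm (hp : 0 < p) (μ ν : WassersteinSpace p X) :
    wassersteinEDist p μ.toProb ν.toProb = wassersteinEDist p ν.toProb μ.toProb :=
  le_antisymm (wassersteinEDist_le_swap hp ν μ) (wassersteinEDist_le_swap hp μ ν)

/-- A sequence of measures with controlled successive Wasserstein distances is realized by a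
sequence of random variables with controlled successive `L^p` distances. -/
theorem exists_realization_of_wassersteinEDist_lt [CompleteSpace X] (hp : 0 < p)
    (u : ℕ → WassersteinSpace p X) {b : ℕ → ℝ≥0∞}
    (hb : ∀ n, wassersteinEDist p (u n).toProb (u (n + 1)).toProb < b n) :
    ∃ S : Set X, IsClosed S ∧ SecondCountableTopology S ∧
      ∃ P : Measure (ℕ → S), IsProbabilityMeasure P ∧
        (∀ n, P.map (fun ω => (ω n : X)) = (u n).toProb) ∧
        ∀ n, lpEDist p P (fun ω => ω n) (fun ω => ω (n + 1)) < b n := by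
  obtain ⟨S, hS, _, hc, r, hrm, hr⟩ := exists_separable_carrier u
  -- Completeness makes `S` Polish, hence standard Borel, as the disintegration in the gluing lemma
  -- requires.
  have := hS.completeSpace_coe
  have hne : Nonempty S := by
    obtain ⟨x⟩ : Nonempty X := ((u 0).toProb : Measure X).nonempty_of_neZero
    exact ⟨r x⟩
  choose γ hγ h1 h2 hlt using fun n =>
    exists_lpEDist_lt_of_wassersteinEDist_lt hp hrm hr (hc n) (hc (n + 1)) (hb n)
  obtain ⟨P, hP, hPγ⟩ := exists_measure_map_succ_eq γ fun n => (h2 n).trans (h1 (n + 1)).symm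
  have hpair : ∀ n, Measurable fun ω : ℕ → S => (ω n, ω (n + 1)) := fun n => by fun_prop
  refine ⟨S, hS, inferInstance, P, hP, fun n => ?_, fun n => ?_⟩
  · refine map_coe_eq_of_map_eq hrm hr (hc n) (measurable_pi_apply n) ?_
    rw [← h1 n, ← hPγ n, Measure.fst, Measure.map_map measurable_fst (hpair n)]
    rfl
  · have := hlt n
    rwa [← hPγ n, lpEDist_map (hpair n) measurable_edist] at this

/-- Minkowski's inequality for three variables on one space whose consecutive pairs realize
near-optimal couplings. -/
theorem wassersteinEDist_triangle [CompleteSpace X] (hp : 1 ≤ p) (μ ν ρ : WassersteinSpace p X) :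
    wassersteinEDist p μ.toProb ρ.toProb ≤
      wassersteinEDist p μ.toProb ν.toProb + wassersteinEDist p ν.toProb ρ.toProb := by
  have hp0 : 0 < p := zero_lt_one.trans_le hp
  suffices key : ∀ a b, wassersteinEDist p μ.toProb ν.toProb < a →
      wassersteinEDist p ν.toProb ρ.toProb < b → wassersteinEDist p μ.toProb ρ.toProb ≤ a + b by
    refine ENNReal.le_of_forall_pos_le_add fun ε hε hfin => ?_
    have hε2 : (ε : ℝ≥0∞) / 2 ≠ 0 := by simpa using hε.ne'
    refine (key _ _ (ENNReal.lt_add_right (ne_top_of_le_ne_top hfin.ne le_self_add) hε2)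
      (ENNReal.lt_add_right (ne_top_of_le_ne_top hfin.ne le_add_self) hε2)).trans_eq ?_
    rw [add_add_add_comm, ENNReal.add_halves]
  intro a b ha hb
  -- The sequence is constant from index 2 on, where successive distances vanish; the bound `1`
  -- there could be any positive number.
  let u : ℕ → WassersteinSpace p X := fun n => if n = 0 then μ else if n = 1 then ν else ρ
  let B : ℕ → ℝ≥0∞ := fun n => if n = 0 then a else if n = 1 then b else 1
  have hB : ∀ n, wassersteinEDist p (u n).toProb (u (n + 1)).toProb < B n := by
    rintro (_ | _ | n)
    · simpa [u, B] using ha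
    · simpa [u, B] using hb
    · simp [u, B, wassersteinEDist_self hp0]
  obtain ⟨S, hS, _, P, _, hlaw, hlt⟩ := exists_realization_of_wassersteinEDist_lt hp0 u hB
  have hm : ∀ n m, Measurable fun ω : ℕ → S => edist (ω n) (ω m) := fun n m =>
    (measurable_pi_apply n).edist (measurable_pi_apply m)
  calc wassersteinEDist p μ.toProb ρ.toProb
      ≤ lpEDist p P (fun ω => ω 0) (fun ω => ω 2) :=
        wassersteinEDist_le_lpEDist hp0 (measurable_pi_apply 0) (measurable_pi_apply 2)
          (hlaw 0) (hlaw 2)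
    _ ≤ lpEDist p P (fun ω => ω 0) (fun ω => ω 1) + lpEDist p P (fun ω => ω 1) (fun ω => ω 2) :=
        lpEDist_triangle hp (hm 0 1).aemeasurable (hm 1 2).aemeasurable
    _ ≤ a + b := add_le_add (hlt 0).le (hlt 1).le

theorem lpEDist_const_lt_top (hp : 1 ≤ p) (μ : WassersteinSpace p X) (x : X) :
    lpEDist p (μ.toProb : Measure X) (fun _ => x) id < ∞ := by
  have hp0 : 0 < p := zero_lt_one.trans_le hp
  obtain ⟨x₀, hx₀⟩ := μ.2.2
  refine (lpEDist_triangle hp (g := fun _ => x₀) aemeasurable_const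
    measurable_edist_right.aemeasurable).trans_lt (ENNReal.add_lt_top.2 ⟨?_, ?_⟩)
  · rw [lpEDist_lt_top_iff hp0]
    simp [hp0.le, edist_ne_top, ENNReal.rpow_lt_top_of_nonneg]
  · exact (lpEDist_lt_top_iff hp0).2 hx₀

theorem lpEDist_const_lt_top_of_law (hp : 1 ≤ p) {Ω : Type*} [MeasurableSpace Ω]
    {P : Measure Ω} {f : Ω → X} (hf : Measurable f) {μ : WassersteinSpace p X}
    (h : P.map f = μ.toProb) (x : X) : lpEDist p P (fun _ => x) f < ∞ := by
  have := lpEDist_const_lt_top hp μ x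
  rwa [← h, lpEDist_map (g := id) hf measurable_edist_right] at this

theorem wassersteinEDist_ne_top (hp : 1 ≤ p) (μ ν : WassersteinSpace p X) :
    wassersteinEDist p μ.toProb ν.toProb ≠ ∞ := by
  have hp0 : 0 < p := zero_lt_one.trans_le hp
  obtain ⟨S, hS, _, hc, r, hrm, hr⟩ := exists_separable_carrier ![μ, ν]
  have hμ : (μ.toProb : Measure X) Sᶜ = 0 := hc 0
  have hν : (ν.toProb : Measure X) Sᶜ = 0 := hc 1
  obtain ⟨x⟩ : Nonempty X := (μ.toProb : Measure X).nonempty_of_neZero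
  -- The independent coupling suffices. Retracting to `S` avoids the possible gap between the
  -- product and Borel σ-algebras on `X × X`.
  let P : Measure (X × X) := (μ.toProb : Measure X).prod (ν.toProb : Measure X)
  have hP1 : P.map Prod.fst = (μ.toProb : Measure X) := by simp [P]
  have hP2 : P.map Prod.snd = (ν.toProb : Measure X) := by simp [P]
  have hf : Measurable fun z : X × X => r z.1 := hrm.comp measurable_fst
  have hg : Measurable fun z : X × X => r z.2 := hrm.comp measurable_snd
  have hfl : P.map (fun z => (r z.1 : X)) = μ.toProb :=
    map_coe_eq_of_map_eq hrm hr hμ hf (by rw [← hP1, Measure.map_map hrm measurable_fst]; rfl)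
  have hgl : P.map (fun z => (r z.2 : X)) = ν.toProb :=
    map_coe_eq_of_map_eq hrm hr hν hg (by rw [← hP2, Measure.map_map hrm measurable_snd]; rfl)
  have hfc : Measurable fun z : X × X => (r z.1 : X) := measurable_subtype_coe.comp hf
  have hgc : Measurable fun z : X × X => (r z.2 : X) := measurable_subtype_coe.comp hg
  have h1 : lpEDist p P (fun _ => x) (fun z => (r z.1 : X)) < ∞ :=
    lpEDist_const_lt_top_of_law hp hfc hfl x
  have h2 : lpEDist p P (fun _ => x) (fun z => (r z.2 : X)) < ∞ :=
    lpEDist_const_lt_top_of_law hp hgc hgl x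
  refine ((wassersteinEDist_le_lpEDist hp0 hf hg hfl hgl).trans_lt ?_).ne
  change lpEDist p P (fun z => (r z.1 : X)) (fun z => (r z.2 : X)) < ∞
  refine (lpEDist_triangle hp (g := fun _ => x) ?_ ?_).trans_lt (ENNReal.add_lt_top.2 ⟨?_, h2⟩)
  · exact (measurable_edist_left.comp hfc).aemeasurable
  · exact (measurable_edist_right.comp hgc).aemeasurable
  · rwa [lpEDist_comm]

/-- A coupling of small cost rarely separates its coordinates by `ε`, so the Lévy–Prokhorov distance
vanishes; the measures then agree on closed sets, a generating π-system. -/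
theorem eq_of_wassersteinEDist_eq_zero (hp : 1 ≤ p) {μ ν : WassersteinSpace p X}
    (h : wassersteinEDist p μ.toProb ν.toProb = 0) : μ = ν := by
  have hp0 : 0 < p := zero_lt_one.trans_le hp
  obtain ⟨S, hS, _, hc, r, hrm, hr⟩ := exists_separable_carrier ![μ, ν]
  have hμ : (μ.toProb : Measure X) Sᶜ = 0 := hc 0
  have hν : (ν.toProb : Measure X) Sᶜ = 0 := hc 1
  have hLP : levyProkhorovEDist (μ.toProb : Measure X) (ν.toProb : Measure X) ≤ 0 := by
    refine levyProkhorovEDist_le_of_forall_le _ _ _ fun ε B hε hεt hB => ?_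
    -- Cost below `ε * ε` lets Markov's inequality at level `ε` leave probability at most `ε`.
    obtain ⟨γ, _, h1, h2, hγ⟩ := exists_lpEDist_lt_of_wassersteinEDist_lt hp0 hrm hr hμ hν
      (h.trans_lt (ENNReal.mul_pos hε.ne' hε.ne'))
    have hm1 : Measurable fun z : S × S => (z.1 : X) := measurable_subtype_coe.comp measurable_fst
    have hm2 : Measurable fun z : S × S => (z.2 : X) := measurable_subtype_coe.comp measurable_snd
    have hmd : Measurable fun z : S × S => edist z.1 z.2 := measurable_edist
    rw [← map_coe_eq_of_map_eq hrm hr hμ measurable_fst h1,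
      ← map_coe_eq_of_map_eq hrm hr hν measurable_snd h2, Measure.map_apply hm1 hB,
      Measure.map_apply hm2 Metric.isOpen_thickening.measurableSet]
    have hmarkov : γ {z | ε ≤ edist z.1 z.2} ≤ ε := by
      have hle := (mul_meas_ge_le_lintegral hmd ε).trans
        ((lintegral_edist_le_lpEDist hp hmd).trans hγ.le)
      exact (ENNReal.mul_le_mul_iff_right hε.ne' hεt.ne).1 hle
    refine (measure_mono ?_).trans ((measure_union_le _ _).trans (add_le_add le_rfl hmarkov))
    intro z hz
    by_cases hd : ε ≤ edist z.1 z.2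
    · exact Or.inr hd
    · refine Or.inl ?_
      rw [Set.mem_preimage, Metric.mem_thickening_iff]
      refine ⟨z.1, hz, ?_⟩
      rw [not_le, edist_comm, edist_dist, ENNReal.ofReal_lt_iff_lt_toReal dist_nonneg hεt.ne] at hd
      exact hd
  refine Subtype.ext (ProbabilityMeasure.toMeasure_injective ?_)
  refine ext_of_generate_finite _ ?_ isPiSystem_isClosed (fun A hA => ?_) (by simp)
  · rw [BorelSpace.measurable_eq (α := X), borel_eq_generateFrom_isClosed]
  · exact measure_eq_measure_of_levyProkhorovEDist_eq_zero_of_isClosed (nonpos_iff_eq_zero.1 hLP)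
      hA ⟨1, one_pos, measure_ne_top _ _⟩ ⟨1, one_pos, measure_ne_top _ _⟩

/-- `P_p(X)` with the Wasserstein distance. -/
@[reducible] def wassersteinMetricSpace [CompleteSpace X] (hp : 1 ≤ p) :
    MetricSpace (WassersteinSpace p X) :=
  let E : EMetricSpace (WassersteinSpace p X) :=
    { edist := fun μ ν => wassersteinEDist p μ.toProb ν.toProb
      edist_self := wassersteinEDist_self (zero_lt_one.trans_le hp)
      edist_comm := wassersteinEDist_comm (zero_lt_one.trans_le hp)
      edist_triangle := wassersteinEDist_triangle hp
      eq_of_edist_eq_zero := eq_of_wassersteinEDist_eq_zero hp }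
  EMetricSpace.toMetricSpace (wassersteinEDist_ne_top hp)

/-- The point of `P_p(X)` given by the law of a random variable with values in a closed separable
subspace, at finite `L^p` distance from a constant. -/
theorem exists_wassersteinSpace_of_law [CompleteSpace X] (hp : 0 < p) {Ω : Type*}
    [MeasurableSpace Ω] {P : Measure Ω} [IsProbabilityMeasure P] {S : Set X} (hS : IsClosed S)
    [SecondCountableTopology S] {g : Ω → S} (hg : Measurable g) {x : X}
    (hx : lpEDist p P (fun _ => x) (fun ω => (g ω : X)) < ∞) :
    ∃ ρ : WassersteinSpace p X, P.map (fun ω => (g ω : X)) = ρ.toProb := by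
  have hgc : Measurable fun ω => (g ω : X) := measurable_subtype_coe.comp hg
  refine ⟨⟨⟨P.map (fun ω => (g ω : X)), Measure.isProbabilityMeasure_map hgc.aemeasurable⟩,
    innerRegular_map_coe hS hg, x, ?_⟩, rfl⟩
  rw [lpEDist_lt_top_iff hp] at hx
  have hm : Measurable fun y : X => edist x y ^ p := measurable_edist_right.pow_const p
  change ∫⁻ y, edist x y ^ p ∂(P.map fun ω => (g ω : X)) < ∞
  rwa [lintegral_map hm hgc]

/-! ### Completeness and density -/

theorem exists_wassersteinEDist_le_tsum [CompleteSpace X] (hp : 1 ≤ p)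
    (u : ℕ → WassersteinSpace p X) {b : ℕ → ℝ≥0∞}
    (hb : ∀ n, wassersteinEDist p (u n).toProb (u (n + 1)).toProb < b n) (hsum : ∑' n, b n ≠ ∞) :
    ∃ ρ : WassersteinSpace p X,
      ∀ n, wassersteinEDist p (u n).toProb ρ.toProb ≤ ∑' k, b (k + n) := by
  have hp0 : 0 < p := zero_lt_one.trans_le hp
  obtain ⟨S, hS, _, P, _, hlaw, hlt⟩ := exists_realization_of_wassersteinEDist_lt hp0 u hb
  have := hS.completeSpace_coe
  obtain ⟨g, hg, hle⟩ := exists_lpEDist_le_tsum hp (f := fun n (ω : ℕ → S) => ω n)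
    (fun n => measurable_pi_apply n) (fun n => (hlt n).le) hsum
  obtain ⟨x⟩ : Nonempty X := ((u 0).toProb : Measure X).nonempty_of_neZero
  have hm0 : Measurable fun ω : ℕ → S => (ω 0 : X) :=
    measurable_subtype_coe.comp (measurable_pi_apply 0)
  have hx : lpEDist p P (fun _ => x) (fun ω => (g ω : X)) < ∞ := by
    refine (lpEDist_triangle hp (g := fun ω => (ω 0 : X))
      (measurable_edist_right.comp hm0).aemeasurable
      ((measurable_pi_apply 0).edist hg).aemeasurable).trans_lt (ENNReal.add_lt_top.2 ⟨?_, ?_⟩)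
    · exact lpEDist_const_lt_top_of_law hp hm0 (hlaw 0) x
    · exact (hle 0).trans_lt (by simpa using hsum.lt_top)
  obtain ⟨ρ, hρ⟩ := exists_wassersteinSpace_of_law hp0 hS hg hx
  exact ⟨ρ, fun n => (wassersteinEDist_le_lpEDist hp0 (measurable_pi_apply n) hg
    (hlaw n) hρ).trans (hle n)⟩

theorem exists_finite_support_wassersteinEDist_lt [CompleteSpace X] (hp : 1 ≤ p)
    (μ : WassersteinSpace p X) {ε : ℝ≥0∞} (hε : 0 < ε) :
    ∃ ρ : WassersteinSpace p X, (ρ.toProb : Measure X).support.Finite ∧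
      wassersteinEDist p μ.toProb ρ.toProb < ε := by
  have hp0 : 0 < p := zero_lt_one.trans_le hp
  obtain ⟨S, hS, _, hμ, r, hrm, hr⟩ := exists_separable_carrier fun _ : Unit => μ
  obtain ⟨x⟩ : Nonempty X := (μ.toProb : Measure X).nonempty_of_neZero
  let y : S := r x
  -- These simple functions start from the constant `y` and never get farther from `r` than `y` is,
  -- so `edist y (r z) ^ p` dominates; it is integrable by the moment condition.
  let f : ℕ → SimpleFunc X S := SimpleFunc.approxOn r hrm Set.univ y (Set.mem_univ _)
  have hlaw := map_coe_eq_of_map_eq hrm hr (hμ ()) hrm rfl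
  have hfin : lpEDist p (μ.toProb : Measure X) (fun _ => y) r < ∞ :=
    lpEDist_const_lt_top_of_law hp (measurable_subtype_coe.comp hrm) hlaw (y : X)
  have hmd : ∀ n, Measurable fun z => edist (r z) (f n z) := fun n => hrm.edist (f n).measurable
  have hlim : Tendsto (fun n => lpEDist p (μ.toProb : Measure X) r (f n)) atTop (𝓝 0) := by
    have h0 : Tendsto (fun n => ∫⁻ z, edist (r z) (f n z) ^ p ∂(μ.toProb : Measure X)) atTop
        (𝓝 (∫⁻ _, 0 ∂(μ.toProb : Measure X))) := by
      refine tendsto_lintegral_of_dominated_convergence (fun z => edist y (r z) ^ p)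
        (fun n => (hmd n).pow_const p) (fun n => ae_of_all _ fun z => ?_)
        ((lpEDist_lt_top_iff hp0).1 hfin).ne (ae_of_all _ fun z => ?_)
      · refine ENNReal.rpow_le_rpow ?_ hp0.le
        rw [edist_comm]
        exact SimpleFunc.edist_approxOn_le hrm _ z n
      · have ht : Tendsto (fun n => f n z) atTop (𝓝 (r z)) :=
          SimpleFunc.tendsto_approxOn hrm _ (by simp)
        have := (ENNReal.continuous_rpow_const (y := p)).tendsto _ |>.comp
          ((tendsto_const_nhds (x := r z)).edist ht)
        simpa [ENNReal.zero_rpow_of_pos hp0, Function.comp_def] using this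
    have := (ENNReal.continuous_rpow_const (y := 1 / p)).tendsto _ |>.comp h0
    simpa [ENNReal.zero_rpow_of_pos, hp0, lpEDist, Function.comp_def] using this
  obtain ⟨n, hn⟩ := (hlim.eventually_lt_const hε).exists
  have hx : lpEDist p (μ.toProb : Measure X) (fun _ => (y : X)) (fun z => (f n z : X)) < ∞ := by
    change lpEDist p (μ.toProb : Measure X) (fun _ => y) (f n) < ∞
    refine (lpEDist_triangle hp (g := r) (measurable_edist_right.comp hrm).aemeasurable
      (hmd n).aemeasurable).trans_lt (ENNReal.add_lt_top.2 ⟨hfin, hn.trans_le le_top⟩)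
  obtain ⟨ρ, hρ⟩ := exists_wassersteinSpace_of_law hp0 hS (f n).measurable hx
  refine ⟨ρ, ?_, (wassersteinEDist_le_lpEDist hp0 hrm (f n).measurable hlaw hρ).trans_lt hn⟩
  have hrange : (Set.range fun z => (f n z : X)).Finite := by
    have := (f n).finite_range.image (Subtype.val : S → X)
    rwa [← Set.range_comp] at this
  refine hrange.subset (Measure.support_subset_of_isClosed hrange.isClosed ?_)
  have hmf : Measurable fun z => (f n z : X) := measurable_subtype_coe.comp (f n).measurable
  rw [← hρ, mem_ae_map_iff hmf.aemeasurable hrange.measurableSet]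
  exact univ_mem' fun z => ⟨z, rfl⟩

end WassersteinMetric

end

theorem mainTheorem3 {X : Type*} [MetricSpace X] [CompleteSpace X] [MeasurableSpace X]
    [BorelSpace X] (p : ℝ) (hp : 1 ≤ p) :
    ∃ _ : MetricSpace (WassersteinSpace p X),
      (∀ μ ν : WassersteinSpace p X, edist μ ν = wassersteinEDist p μ.toProb ν.toProb) ∧
      CompleteSpace (WassersteinSpace p X) ∧
      Dense {μ : WassersteinSpace p X | (μ.toProb : Measure X).support.Finite} := by
  let _ : MetricSpace (WassersteinSpace p X) := wassersteinMetricSpace hp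
  -- `EMetricSpace.toMetricSpace` keeps the given `edist`, so this holds by definition; finiteness
  -- is part of being a `MetricSpace`.
  have hed : ∀ μ ν : WassersteinSpace p X,
      edist μ ν = wassersteinEDist p μ.toProb ν.toProb := fun _ _ => rfl
  refine ⟨inferInstance, hed, ?_, ?_⟩
  · refine EMetric.complete_of_convergent_controlled_sequences (fun n => (2⁻¹ : ℝ≥0∞) ^ n)
      (fun n => ENNReal.pow_pos (by simp) n) fun u hu => ?_
    have hsum : ∑' n : ℕ, (2⁻¹ : ℝ≥0∞) ^ n ≠ ∞ := by
      rw [ENNReal.tsum_geometric, ENNReal.one_sub_inv_two, inv_inv]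
      exact ENNReal.ofNat_ne_top
    obtain ⟨ρ, hρ⟩ := exists_wassersteinEDist_le_tsum hp u
      (fun n => hu n n (n + 1) le_rfl n.le_succ) hsum
    refine ⟨ρ, tendsto_iff_edist_tendsto_0.2 ?_⟩
    exact tendsto_of_tendsto_of_tendsto_of_le_of_le tendsto_const_nhds
      (ENNReal.tendsto_sum_nat_add _ hsum) (fun _ => zero_le) hρ
  · refine fun μ => EMetric.mem_closure_iff.2 fun ε hε => ?_
    obtain ⟨ρ, hfin, hlt⟩ := exists_finite_support_wassersteinEDist_lt hp μ hε
    exact ⟨ρ, hfin, hlt⟩
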